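/- Let $d=(d_1,d_2)\in\mathbb R^2$ with $d_1\ge 0$, $d_2\ge 0$, $d_1d_2\ge 1$, and let \[ Z_+=\{(x,y,t)\in\{0,1\}^2\times\mathbb R_+^2\times\mathbb R_+ : y_i(1-x_i)=0\ (i=1,2),\ t\ge d_1y_1^2+2y_1y_2+d_2y_2^2\}. \] For $x\in[0,1]^2$, $y\in\mathbb R_+^2$ and $\lambda\in\mathbb R$ put \[ f(x,y,\lambda;d)=\frac{(d_1d_2-1)(d_1x_2y_1^2+d_2x_1y_2^2)+2\lambda d_1d_2y_1y_2+\lambda(d_1y_1^2+d_2y_2^2)}{(d_1d_2-1)x_1x_2-\lambda^2+\lambda(x_1+x_2)} \] and \[ f_+^*(x,y;d)=\begin{cases} \frac{d_1y_1^2}{x_1}+\frac{d_2y_2^2}{x_2} & \text{if } x_1+x_2\le 1,\\ \frac{d_2y_2^2}{x_2}+\frac{d_1y_1^2}{1-x_2} & \text{if } 0\le x_1+x_2-1\le (x_1y_2-d_1x_2y_1)/y_2,\\ \frac{d_1y_1^2}{x_1}+\frac{d_2y_2^2}{1-x_1} & \text{if } 0\le x_1+x_2-1\le (x_2y_1-d_2x_1y_2)/y_1,\\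 f(x,y,x_1+x_2-1;d) & \text{otherwise,} \end{cases} \] where the first case that applies is used, the second case is taken not to apply if $y_2=0$ and the third not to apply if $y_1=0$, and in the values of the first three cases $a/0=\infty$ for $a>0$ and $0/0=0$. Then the closure of the convex hull of $Z_+$ in $\mathbb R^5$ is \[ \operatorname{cl}\operatorname{conv}(Z_+)=\{(x,y,t)\in[0,1]^2\times\mathbb R_+^3 : t\ge f_+^*(x,y;d)\}. \] -/

import Mathlib

namespace IndicatorHull

noncomputable section

/-- Mixed-integer indicator set: `x ∈ {0,1}ⁿ`, `y ∈ ℝ₊ⁿ`, `yᵢ (1 - xᵢ) = 0`. -/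
def indicatorSet (n : ℕ) : Set ((Fin n → ℝ) × (Fin n → ℝ)) :=
  {p | (∀ i, p.1 i = 0 ∨ p.1 i = 1) ∧ (∀ i, 0 ≤ p.2 i) ∧ (∀ i, p.2 i * (1 - p.1 i) = 0)}

/-- Admissible coefficients `d = (d₁, d₂)`. -/
def coeffSet : Set (Fin 2 → ℝ) :=
  {d | 0 ≤ d 0 ∧ 0 ≤ d 1 ∧ 1 ≤ d 0 * d 1}

/-- The set `Z₊` of points `(x, y, t)`: the epigraph of `d₁ y₁² + 2 y₁ y₂ + d₂ y₂²` with
indicators. The coordinates `1, 2` of the mathematics are `0, 1` in `Fin 2`. -/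
def Zplus (d : Fin 2 → ℝ) : Set ((Fin 2 → ℝ) × (Fin 2 → ℝ) × ℝ) :=
  {p | (p.1, p.2.1) ∈ indicatorSet 2 ∧ 0 ≤ p.2.2 ∧
    d 0 * p.2.1 0 ^ 2 + 2 * p.2.1 0 * p.2.1 1 + d 1 * p.2.1 1 ^ 2 ≤ p.2.2}

/-- The quotient `a / b` of nonnegative reals with the convention `0 / 0 = 0` and
`a / 0 = ∞` for `a ≠ 0`. -/
def quot (a b : ℝ) : EReal :=
  if b = 0 then (if a = 0 then 0 else ⊤) else ((a / b : ℝ) : EReal)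

/-- The rational function `f(x, y, l; d)`. It is used below only with
`l = x₁ + x₂ - 1 > 0` and `x ∈ [0,1]²`, where the denominator is positive. -/
def ratFun (x y : Fin 2 → ℝ) (l : ℝ) (d : Fin 2 → ℝ) : ℝ :=
  ((d 0 * d 1 - 1) * (d 0 * x 1 * y 0 ^ 2 + d 1 * x 0 * y 1 ^ 2)
      + 2 * l * d 0 * d 1 * y 0 * y 1 + l * (d 0 * y 0 ^ 2 + d 1 * y 1 ^ 2))
    / ((d 0 * d 1 - 1) * x 0 * x 1 - l ^ 2 + l * (x 0 + x 1))

/-- The four-piece function `f₊*(x, y; d)`, with value `∞` where a term has a positive numerator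
and denominator zero.
In the second and third conditions Lean's real quotient by `y i = 0` is `0`; these conditions are
only reached when `x₁ + x₂ - 1 > 0`, so they then fail, as they should (for `y₁, y₂ ≥ 0` the
quotient there would be `-∞` or `0 / 0 = 0`). -/
def fPlus (x y d : Fin 2 → ℝ) : EReal :=
  if x 0 + x 1 ≤ 1 then
    quot (d 0 * y 0 ^ 2) (x 0) + quot (d 1 * y 1 ^ 2) (x 1)
  else if 0 ≤ x 0 + x 1 - 1 ∧ x 0 + x 1 - 1 ≤ (x 0 * y 1 - d 0 * x 1 * y 0) / y 1 then
    quot (d 1 * y 1 ^ 2) (x 1) + quot (d 0 * y 0 ^ 2) (1 - x 1)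
  else if 0 ≤ x 0 + x 1 - 1 ∧ x 0 + x 1 - 1 ≤ (x 1 * y 0 - d 1 * x 0 * y 1) / y 0 then
    quot (d 0 * y 0 ^ 2) (x 0) + quot (d 1 * y 1 ^ 2) (1 - x 0)
  else
    ((ratFun x y (x 0 + x 1 - 1) d : ℝ) : EReal)

end

end IndicatorHull

namespace IndicatorHull

/-! A point of the hull mixes the pieces x = (0,0), (1,0), (0,1), (1,1) with masses a, b, c, e, and
by convexity one y per piece suffices. For x₁ + x₂ ≤ 1 take e = 0, so that the cross term costs
nothing. Otherwise take a = 0, which forces b = 1 - x₂, c = 1 - x₁, e = x₁ + x₂ - 1. The remaining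
problem is to split y among the pieces at least cost, and f₊* is its value: in cases 2 and 3 the
point w of the full piece has a zero coordinate, in case 4 it is stationary.

`mem_convexHull_of_weights` realises the optimal splitting. `valid_inequality`, with tangent slopes
taken at the same splitting, gives the matching lower bound. Upper bounds are attained in the hull
itself, so the closure adds nothing. -/

lemma quot_add_quot_le_iff (a b c e t : ℝ) :
    quot a b + quot c e ≤ (t : EReal) ↔
      (b = 0 → a = 0) ∧ (e = 0 → c = 0) ∧ a / b + c / e ≤ t := by
  unfold quot
  split_ifs with hb ha he hc he hc he hc <;>
    simp_all [← EReal.coe_add]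

lemma coeffSet_pos {d : Fin 2 → ℝ} (hd : d ∈ coeffSet) : 0 < d 0 ∧ 0 < d 1 := by
  obtain ⟨h0, h1, h⟩ := hd
  constructor
  · rcases h0.lt_or_eq with h0 | h0
    · exact h0
    · rw [← h0] at h; linarith
  · rcases h1.lt_or_eq with h1 | h1
    · exact h1
    · rw [← h1] at h; linarith

/-- Explicit convex combinations of one point of each of the four pieces of `Zplus d`. -/
lemma mem_convexHull_of_weights {d : Fin 2 → ℝ} (hd : d ∈ coeffSet)
    {a b c e r₁ r₂ w₁ w₂ t : ℝ} (ha : 0 ≤ a) (hb : 0 ≤ b) (hc : 0 ≤ c) (he : 0 ≤ e)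
    (hsum : a + b + c + e = 1) (hr₁ : 0 ≤ r₁) (hr₂ : 0 ≤ r₂) (hw₁ : 0 ≤ w₁) (hw₂ : 0 ≤ w₂)
    (ht : b * (d 0 * r₁ ^ 2) + c * (d 1 * r₂ ^ 2)
      + e * (d 0 * w₁ ^ 2 + 2 * w₁ * w₂ + d 1 * w₂ ^ 2) ≤ t)
    {x y : Fin 2 → ℝ} (hx₁ : x 0 = b + e) (hx₂ : x 1 = c + e)
    (hy₁ : y 0 = b * r₁ + e * w₁) (hy₂ : y 1 = c * r₂ + e * w₂) :
    (x, y, t) ∈ convexHull ℝ (Zplus d) := by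
  obtain ⟨hd0, hd1⟩ := coeffSet_pos hd
  -- The slack s lifts all four points equally, since the masses sum to 1.
  obtain ⟨s, hs, rfl⟩ : ∃ s, 0 ≤ s ∧ t = s + (b * (d 0 * r₁ ^ 2) + c * (d 1 * r₂ ^ 2)
      + e * (d 0 * w₁ ^ 2 + 2 * w₁ * w₂ + d 1 * w₂ ^ 2)) :=
    ⟨_, sub_nonneg.2 ht, by ring⟩
  let P : Fin 4 → (Fin 2 → ℝ) × (Fin 2 → ℝ) × ℝ :=
    ![(![0, 0], ![0, 0], s), (![1, 0], ![r₁, 0], s + d 0 * r₁ ^ 2),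
      (![0, 1], ![0, r₂], s + d 1 * r₂ ^ 2),
      (![1, 1], ![w₁, w₂], s + (d 0 * w₁ ^ 2 + 2 * w₁ * w₂ + d 1 * w₂ ^ 2))]
  have hP : ∀ i, P i ∈ convexHull ℝ (Zplus d) := by
    intro i
    apply subset_convexHull
    fin_cases i <;> simp only [P, Zplus, indicatorSet, Fin.forall_fin_two, Set.mem_ofPred_eq] <;>
      simp [*] <;> positivity
  have h := (convex_convexHull ℝ (Zplus d)).sum_mem (t := Finset.univ) (w := ![a, b, c, e])
    (z := P) (by intro i _; fin_cases i <;> simpa) (by simp [Fin.sum_univ_four, hsum])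
    (fun i _ => hP i)
  convert h using 1
  simp only [Fin.sum_univ_four, P]
  ext i
  · fin_cases i <;> simp [hx₁, hx₂]
  · fin_cases i <;> simp [hy₁, hy₂]
  · simp
    linear_combination -s * hsum

/-! ### Outer description: valid inequalities -/

/-- A family of linear inequalities valid for `Zplus d`, hence for its closed convex hull. -/
lemma valid_inequality {d : Fin 2 → ℝ} (hd : d ∈ coeffSet) {b₁ b₂ c₁ c₂ c₃ : ℝ}
    (h₁ : b₁ ^ 2 ≤ d 0 * c₁) (h₂ : b₂ ^ 2 ≤ d 1 * c₂) (h₁₂ : c₃ ≤ c₁ + c₂)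
    (h₃ : ∀ v₁ v₂ : ℝ, 0 ≤ v₁ → 0 ≤ v₂ →
      2 * b₁ * v₁ + 2 * b₂ * v₂ - c₃ ≤ d 0 * v₁ ^ 2 + 2 * v₁ * v₂ + d 1 * v₂ ^ 2)
    {p : (Fin 2 → ℝ) × (Fin 2 → ℝ) × ℝ} (hp : p ∈ closure (convexHull ℝ (Zplus d))) :
    2 * b₁ * p.2.1 0 + 2 * b₂ * p.2.1 1 - c₁ * (1 - p.1 1) - c₂ * (1 - p.1 0)
      - c₃ * (p.1 0 + p.1 1 - 1) ≤ p.2.2 := by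
  obtain ⟨hd0, hd1⟩ := coeffSet_pos hd
  have key : ∀ {D b c : ℝ}, 0 < D → b ^ 2 ≤ D * c → ∀ v : ℝ, 2 * b * v - c ≤ D * v ^ 2 := by
    intro D b c hD h v
    have : 0 ≤ D * (D * v ^ 2 - (2 * b * v - c)) := by nlinarith [sq_nonneg (D * v - b)]
    linarith [nonneg_of_mul_nonneg_right this hD]
  refine closure_minimal (s := convexHull ℝ (Zplus d)) (t := {p | 2 * b₁ * p.2.1 0
    + 2 * b₂ * p.2.1 1 - c₁ * (1 - p.1 1) - c₂ * (1 - p.1 0)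
      - c₃ * (p.1 0 + p.1 1 - 1) ≤ p.2.2}) (convexHull_min ?_ ?_) ?_ hp
  · rintro ⟨x, y, t⟩ ⟨⟨hx, hy, hxy⟩, ht, hq⟩
    simp only [Fin.forall_fin_two, Set.mem_ofPred_eq] at hx hy hxy ht hq ⊢
    obtain ⟨hx0, hx1⟩ := hx
    obtain ⟨hxy0, hxy1⟩ := hxy
    rcases hx0 with hx0 | hx0 <;> rcases hx1 with hx1 | hx1 <;> rw [hx0] at hxy0 ⊢ <;>
      rw [hx1] at hxy1 ⊢ <;> norm_num at hxy0 hxy1 ⊢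
    · rw [hxy0, hxy1]; linarith
    · rw [hxy0] at hq ⊢
      linarith [key hd1 h₂ (y 1)]
    · rw [hxy1] at hq ⊢
      linarith [key hd0 h₁ (y 0)]
    · linarith [h₃ _ _ hy.1 hy.2]
  · intro p hp q hq a b ha hb hab
    simp only [Set.mem_ofPred_eq, Prod.fst_add, Prod.snd_add, Prod.smul_fst, Prod.smul_snd,
      Pi.add_apply, Pi.smul_apply, smul_eq_mul] at hp hq ⊢
    have := add_le_add (mul_le_mul_of_nonneg_left hp ha) (mul_le_mul_of_nonneg_left hq hb)
    refine le_trans (le_of_eq ?_) this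
    linear_combination (c₁ + c₂ - c₃) * hab
  · exact isClosed_le (by fun_prop) (by fun_prop)

lemma mem_box_of_mem_closure {d : Fin 2 → ℝ} {p : (Fin 2 → ℝ) × (Fin 2 → ℝ) × ℝ}
    (hp : p ∈ closure (convexHull ℝ (Zplus d))) :
    (∀ i, p.1 i ∈ Set.Icc (0 : ℝ) 1) ∧ (∀ i, 0 ≤ p.2.1 i) ∧ 0 ≤ p.2.2 := by
  have hbox : {p : (Fin 2 → ℝ) × (Fin 2 → ℝ) × ℝ | (∀ i, p.1 i ∈ Set.Icc (0 : ℝ) 1) ∧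
      (∀ i, 0 ≤ p.2.1 i) ∧ 0 ≤ p.2.2} =
      Set.Icc (0 : Fin 2 → ℝ) 1 ×ˢ Set.Ici (0 : Fin 2 → ℝ) ×ˢ Set.Ici (0 : ℝ) := by
    ext p
    simp only [Set.mem_ofPred_eq, Set.mem_prod, Set.mem_Icc, Set.mem_Ici, Pi.le_def, forall_and,
      Pi.zero_apply, Pi.one_apply]
  have h := closure_minimal (s := convexHull ℝ (Zplus d)) (t := {p | (∀ i, p.1 i ∈
    Set.Icc (0 : ℝ) 1) ∧ (∀ i, 0 ≤ p.2.1 i) ∧ 0 ≤ p.2.2}) (convexHull_min ?_ ?_) ?_ hp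
  · exact h
  · rintro p ⟨⟨hx, hy, -⟩, ht, -⟩
    refine ⟨fun i => ?_, hy, ht⟩
    rcases hx i with h | h <;> dsimp only at h <;> rw [h] <;> norm_num
  · rw [hbox]
    exact (convex_Icc _ _).prod ((convex_Ici _).prod (convex_Ici _))
  · rw [hbox]
    exact isClosed_Icc.prod (isClosed_Ici.prod isClosed_Ici)

lemma le_div_iff_of_overlap {x₁ x₂ y₁ y₂ δ : ℝ} (hy₂ : 0 ≤ y₂) (hL : 0 < x₁ + x₂ - 1) :
    (0 ≤ x₁ + x₂ - 1 ∧ x₁ + x₂ - 1 ≤ (x₁ * y₂ - δ * x₂ * y₁) / y₂) ↔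
      0 < y₂ ∧ δ * x₂ * y₁ ≤ (1 - x₂) * y₂ := by
  rcases hy₂.eq_or_lt with h | h
  · subst h; simp; intro; linarith
  · rw [le_div_iff₀ h]
    constructor
    · rintro ⟨-, h'⟩; exact ⟨h, by linarith⟩
    · rintro ⟨-, h'⟩; exact ⟨hL.le, by linarith⟩

/-- The best tangent of δv² has slope point y / x. At x = 0 both sides vanish because y / 0 = 0. -/
lemma mul_sq_div_eq (δ y x : ℝ) :
    2 * (δ * (y / x)) * y - δ * (y / x) ^ 2 * x = δ * y ^ 2 / x := by
  rcases eq_or_ne x 0 with hx | hx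
  · simp [hx]
  · field_simp; ring

/-! ### Lower bounds on t, piece by piece -/

section LowerBounds

variable {d : Fin 2 → ℝ} {x y : Fin 2 → ℝ} {t : ℝ}

lemma separable_inequality (hd : d ∈ coeffSet)
    (hp : (x, y, t) ∈ closure (convexHull ℝ (Zplus d))) (a₁ a₂ : ℝ) :
    (2 * (d 0 * a₁) * y 0 - d 0 * a₁ ^ 2 * x 0)
      + (2 * (d 1 * a₂) * y 1 - d 1 * a₂ ^ 2 * x 1) ≤ t := by
  obtain ⟨hd0, hd1⟩ := coeffSet_pos hd
  -- With c₃ = c₁ + c₂ the constant term cancels, leaving -c₁x₁ - c₂x₂.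
  have h := valid_inequality hd (b₁ := d 0 * a₁) (b₂ := d 1 * a₂) (c₁ := d 0 * a₁ ^ 2)
    (c₂ := d 1 * a₂ ^ 2) (c₃ := d 0 * a₁ ^ 2 + d 1 * a₂ ^ 2) (by linarith) (by linarith) le_rfl
    (fun v₁ v₂ h₁ h₂ => by
      have h1 : 0 ≤ d 0 * (v₁ - a₁) ^ 2 := by positivity
      have h2 : 0 ≤ d 1 * (v₂ - a₂) ^ 2 := by positivity
      have h3 : 0 ≤ v₁ * v₂ := by positivity
      linarith) hp
  dsimp only at h
  linarith

lemma eq_zero_of_forall_mul_le {u s : ℝ} (h : ∀ a : ℝ, a * u ≤ s) : u = 0 := by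
  by_contra hu
  have := h ((s + 1) / u)
  rw [div_mul_cancel₀ _ hu] at this
  linarith

lemma separable_quot_le (hd : d ∈ coeffSet)
    (hp : (x, y, t) ∈ closure (convexHull ℝ (Zplus d))) :
    quot (d 0 * y 0 ^ 2) (x 0) + quot (d 1 * y 1 ^ 2) (x 1) ≤ (t : EReal) := by
  obtain ⟨hd0, hd1⟩ := coeffSet_pos hd
  have h := separable_inequality hd hp
  have h1 : x 0 = 0 → d 0 * y 0 ^ 2 = 0 := fun hx => by
    have : d 0 * y 0 = 0 := eq_zero_of_forall_mul_le (s := t) fun a => by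
      have := h (a / 2) 0
      rw [hx] at this; linarith
    rw [sq, ← mul_assoc, this, zero_mul]
  have h2 : x 1 = 0 → d 1 * y 1 ^ 2 = 0 := fun hx => by
    have : d 1 * y 1 = 0 := eq_zero_of_forall_mul_le (s := t) fun a => by
      have := h 0 (a / 2)
      rw [hx] at this; linarith
    rw [sq, ← mul_assoc, this, zero_mul]
  rw [quot_add_quot_le_iff]
  refine ⟨h1, h2, ?_⟩
  rw [← mul_sq_div_eq (d 0), ← mul_sq_div_eq (d 1)]
  exact h _ _

lemma div_le_div_of_mul_le {δ x y z u : ℝ} (hx : 0 < x) (hu : 0 ≤ u) (hz : 0 ≤ z)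
    (h : δ * x * y ≤ u * z) : δ * (y / u) ≤ z / x := by
  rcases hu.eq_or_lt with rfl | hu
  · simp; positivity
  · rw [← mul_div_assoc, div_le_div_iff₀ hu hx]; linarith

lemma eq_zero_of_mul_le {δ x y z u : ℝ} (hδ : 0 < δ) (hx : 0 < x) (hy : 0 ≤ y)
    (h : δ * x * y ≤ u * z) (hu : u = 0) : y = 0 := by
  rw [hu, zero_mul] at h
  have := mul_pos hδ hx
  nlinarith

/-- The optimal full-piece point is (0, w) with w = y₂ / x₂. The hypothesis `h` gives d₁a ≤ w for a
= y₁ / (1 - x₂), the KKT sign condition at the zero coordinate; when x₂ = 1 it forces y₁ = 0. -/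
lemma quot_le_of_snd_dominant (hd : d ∈ coeffSet) (hx : x 1 ≤ 1) (hx' : 0 < x 1)
    (hy : ∀ i, 0 ≤ y i) (h : d 0 * x 1 * y 0 ≤ (1 - x 1) * y 1)
    (hp : (x, y, t) ∈ closure (convexHull ℝ (Zplus d))) :
    quot (d 1 * y 1 ^ 2) (x 1) + quot (d 0 * y 0 ^ 2) (1 - x 1) ≤ (t : EReal) := by
  obtain ⟨hd0, hd1⟩ := coeffSet_pos hd
  have h1 : 1 - x 1 = 0 → d 0 * y 0 ^ 2 = 0 := fun hu => by
    rw [eq_zero_of_mul_le hd0 hx' (hy 0) h hu]; ring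
  have h2 : x 1 = 0 → d 1 * y 1 ^ 2 = 0 := fun h => absurd h hx'.ne'
  rw [quot_add_quot_le_iff]
  refine ⟨h2, h1, ?_⟩
  rw [← mul_sq_div_eq (d 0), ← mul_sq_div_eq (d 1)]
  have hle := div_le_div_of_mul_le hx' (sub_nonneg.2 hx) (hy 1) h
  generalize y 0 / (1 - x 1) = a at *
  generalize y 1 / x 1 = w at *
  have := valid_inequality hd (b₁ := d 0 * a) (b₂ := d 1 * w) (c₁ := d 0 * a ^ 2)
    (c₂ := d 1 * w ^ 2) (c₃ := d 1 * w ^ 2) (by linarith) (by linarith)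
    (le_add_of_nonneg_left (by positivity))
    (fun v₁ v₂ h₁ h₂ => by
      have h1 : 0 ≤ (w - d 0 * a) * v₁ := mul_nonneg (sub_nonneg.2 hle) h₁
      -- The right side equals (v₁ + d₂(v₂ - w))² + (d₁d₂ - 1)v₁².
      have h2 : 0 ≤ d 1 * (d 0 * v₁ ^ 2 + 2 * v₁ * v₂ + d 1 * v₂ ^ 2 - 2 * w * v₁
          - 2 * (d 1 * w) * v₂ + d 1 * w ^ 2) := by
        have := mul_nonneg (sub_nonneg.2 hd.2.2) (sq_nonneg v₁)
        linarith [sq_nonneg (v₁ + d 1 * (v₂ - w))]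
      linarith [nonneg_of_mul_nonneg_right h2 hd1]) hp
  dsimp only at this
  linarith

lemma quot_le_of_fst_dominant (hd : d ∈ coeffSet) (hx : x 0 ≤ 1) (hx' : 0 < x 0)
    (hy : ∀ i, 0 ≤ y i) (h : d 1 * x 0 * y 1 ≤ (1 - x 0) * y 0)
    (hp : (x, y, t) ∈ closure (convexHull ℝ (Zplus d))) :
    quot (d 0 * y 0 ^ 2) (x 0) + quot (d 1 * y 1 ^ 2) (1 - x 0) ≤ (t : EReal) := by
  obtain ⟨hd0, hd1⟩ := coeffSet_pos hd
  have h1 : 1 - x 0 = 0 → d 1 * y 1 ^ 2 = 0 := fun hu => by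
    rw [eq_zero_of_mul_le hd1 hx' (hy 1) h hu]; ring
  have h2 : x 0 = 0 → d 0 * y 0 ^ 2 = 0 := fun h => absurd h hx'.ne'
  rw [quot_add_quot_le_iff]
  refine ⟨h2, h1, ?_⟩
  rw [← mul_sq_div_eq (d 0), ← mul_sq_div_eq (d 1)]
  have hle := div_le_div_of_mul_le hx' (sub_nonneg.2 hx) (hy 0) h
  generalize y 1 / (1 - x 0) = a at *
  generalize y 0 / x 0 = w at *
  have := valid_inequality hd (b₁ := d 0 * w) (b₂ := d 1 * a) (c₁ := d 0 * w ^ 2)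
    (c₂ := d 1 * a ^ 2) (c₃ := d 0 * w ^ 2) (by linarith) (by linarith)
    (le_add_of_nonneg_right (by positivity))
    (fun v₁ v₂ h₁ h₂ => by
      have h1 : 0 ≤ (w - d 1 * a) * v₂ := mul_nonneg (sub_nonneg.2 hle) h₂
      have h2 : 0 ≤ d 0 * (d 0 * v₁ ^ 2 + 2 * v₁ * v₂ + d 1 * v₂ ^ 2 - 2 * w * v₂
          - 2 * (d 0 * w) * v₁ + d 0 * w ^ 2) := by
        have := mul_nonneg (sub_nonneg.2 hd.2.2) (sq_nonneg v₂)
        linarith [sq_nonneg (v₂ + d 0 * (v₁ - w))]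
      linarith [nonneg_of_mul_nonneg_right h2 hd0]) hp
  dsimp only at this
  linarith

/-- The slopes are half the gradient of the quadratic form at w, so the bound on the full piece is
its tangent plane. Nonnegativity of w is what makes the inequality hold at the origin piece. -/
lemma quadratic_inequality (hd : d ∈ coeffSet)
    (hp : (x, y, t) ∈ closure (convexHull ℝ (Zplus d))) {w₁ w₂ : ℝ}
    (hw₁ : 0 ≤ w₁) (hw₂ : 0 ≤ w₂) :
    2 * (d 0 * w₁ + w₂) * y 0 + 2 * (w₁ + d 1 * w₂) * y 1
      - (d 0 * w₁ + w₂) ^ 2 / d 0 * (1 - x 1) - (w₁ + d 1 * w₂) ^ 2 / d 1 * (1 - x 0)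
      - (d 0 * w₁ ^ 2 + 2 * w₁ * w₂ + d 1 * w₂ ^ 2) * (x 0 + x 1 - 1) ≤ t := by
  obtain ⟨hd0, hd1⟩ := coeffSet_pos hd
  refine valid_inequality hd (mul_div_cancel₀ _ hd0.ne').ge (mul_div_cancel₀ _ hd1.ne').ge ?_
    (fun v₁ v₂ _ _ => ?_) hp
  · have h1 : (d 0 * w₁ + w₂) ^ 2 / d 0 = d 0 * w₁ ^ 2 + 2 * w₁ * w₂ + w₂ ^ 2 / d 0 := by
      field_simp; ring
    have h2 : (w₁ + d 1 * w₂) ^ 2 / d 1 = d 1 * w₂ ^ 2 + 2 * w₁ * w₂ + w₁ ^ 2 / d 1 := by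
      field_simp; ring
    rw [h1, h2]
    have : 0 ≤ 2 * w₁ * w₂ + w₂ ^ 2 / d 0 + w₁ ^ 2 / d 1 := by positivity
    linarith
  · have h : 0 ≤ d 0 * (d 0 * (v₁ - w₁) ^ 2 + 2 * (v₁ - w₁) * (v₂ - w₂)
        + d 1 * (v₂ - w₂) ^ 2) := by
      have := mul_nonneg (sub_nonneg.2 hd.2.2) (sq_nonneg (v₂ - w₂))
      linarith [sq_nonneg (d 0 * (v₁ - w₁) + (v₂ - w₂))]
    linarith [nonneg_of_mul_nonneg_right h hd0]

end LowerBounds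

/-! ### The rational piece -/

lemma ratFun_denom_pos {d x : Fin 2 → ℝ} (hd : d ∈ coeffSet) (hx : ∀ i, 0 ≤ x i)
    (hL : 0 < x 0 + x 1 - 1) :
    0 < (d 0 * d 1 - 1) * x 0 * x 1 + (x 0 + x 1 - 1) :=
  add_pos_of_nonneg_of_pos
    (mul_nonneg (mul_nonneg (sub_nonneg.2 hd.2.2) (hx 0)) (hx 1)) hL

lemma ratFun_eq (d x y : Fin 2 → ℝ) :
    ratFun x y (x 0 + x 1 - 1) d =
      ((d 0 * d 1 - 1) * (d 0 * x 1 * y 0 ^ 2 + d 1 * x 0 * y 1 ^ 2)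
        + 2 * (x 0 + x 1 - 1) * d 0 * d 1 * y 0 * y 1
        + (x 0 + x 1 - 1) * (d 0 * y 0 ^ 2 + d 1 * y 1 ^ 2))
      / ((d 0 * d 1 - 1) * x 0 * x 1 + (x 0 + x 1 - 1)) := by
  unfold ratFun
  congr 1
  ring

/-- In the region of the fourth piece both components of the optimal point of the full piece are
nonnegative. -/
lemma nonneg_of_not_dominant {u₁ u₂ v₁ v₂ y₁ y₂ : ℝ} (hy₁ : 0 ≤ y₁) (hy₂ : 0 ≤ y₂)
    (hu₁ : 0 ≤ u₁) (hu₂ : 0 ≤ u₂)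
    (h₂ : ¬ (0 < y₂ ∧ v₁ * y₁ ≤ u₂ * y₂)) (h₃ : ¬ (0 < y₁ ∧ v₂ * y₂ ≤ u₁ * y₁)) :
    0 ≤ v₁ * y₁ - u₂ * y₂ ∧ 0 ≤ v₂ * y₂ - u₁ * y₁ := by
  rcases hy₁.eq_or_lt with rfl | hy₁ <;> rcases hy₂.eq_or_lt with rfl | hy₂
  · simp
  · exact absurd ⟨hy₂, by simpa using mul_nonneg hu₂ hy₂.le⟩ h₂
  · exact absurd ⟨hy₁, by simpa using mul_nonneg hu₁ hy₁.le⟩ h₃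
  · simp only [hy₁, hy₂, true_and, not_le] at h₂ h₃
    constructor <;> linarith

section RatFun

variable {d x y : Fin 2 → ℝ} {t : ℝ}

lemma ratFun_le (hd : d ∈ coeffSet) (hx : ∀ i, 0 ≤ x i) (hL : 0 < x 0 + x 1 - 1)
    (h₁ : 0 ≤ d 0 * x 1 * y 0 - (1 - x 1) * y 1) (h₂ : 0 ≤ d 1 * x 0 * y 1 - (1 - x 0) * y 0)
    (hp : (x, y, t) ∈ closure (convexHull ℝ (Zplus d))) :
    ratFun x y (x 0 + x 1 - 1) d ≤ t := by
  obtain ⟨hd0, hd1⟩ := coeffSet_pos hd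
  have hD := ratFun_denom_pos hd hx hL
  rw [ratFun_eq]
  refine le_of_eq_of_le ?_ (quadratic_inequality hd hp
    -- Equal gradients across pieces give x₁w₁ + (1 - x₂)w₂/d₁ = y₁ and (1 - x₁)w₁/d₂ + x₂w₂ = y₂;
    -- this w is Cramer's solution.
    (w₁ := d 1 * (d 0 * x 1 * y 0 - (1 - x 1) * y 1)
      / ((d 0 * d 1 - 1) * x 0 * x 1 + (x 0 + x 1 - 1)))
    (w₂ := d 0 * (d 1 * x 0 * y 1 - (1 - x 0) * y 0)
      / ((d 0 * d 1 - 1) * x 0 * x 1 + (x 0 + x 1 - 1))) (by positivity) (by positivity))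
  generalize hDD : (d 0 * d 1 - 1) * x 0 * x 1 + (x 0 + x 1 - 1) = D at *
  field_simp
  rw [← hDD]
  ring

lemma mem_convexHull_of_ratFun_le (hd : d ∈ coeffSet) (hx : ∀ i, x i ∈ Set.Icc (0 : ℝ) 1)
    (hL : 0 < x 0 + x 1 - 1)
    (h₁ : 0 ≤ d 0 * x 1 * y 0 - (1 - x 1) * y 1) (h₂ : 0 ≤ d 1 * x 0 * y 1 - (1 - x 0) * y 0)
    (ht : ratFun x y (x 0 + x 1 - 1) d ≤ t) :
    (x, y, t) ∈ convexHull ℝ (Zplus d) := by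
  obtain ⟨hd0, hd1⟩ := coeffSet_pos hd
  have hD := ratFun_denom_pos hd (fun i => (hx i).1) hL
  rw [ratFun_eq] at ht
  have hw₁ : 0 ≤ d 1 * (d 0 * x 1 * y 0 - (1 - x 1) * y 1)
      / ((d 0 * d 1 - 1) * x 0 * x 1 + (x 0 + x 1 - 1)) := by positivity
  have hw₂ : 0 ≤ d 0 * (d 1 * x 0 * y 1 - (1 - x 0) * y 0)
      / ((d 0 * d 1 - 1) * x 0 * x 1 + (x 0 + x 1 - 1)) := by positivity
  -- The choices d₁r₁ = d₁w₁ + w₂ and d₂r₂ = w₁ + d₂w₂ match the gradients on the single-indicator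
  -- pieces to that at w.
  refine mem_convexHull_of_weights hd le_rfl (sub_nonneg.2 (hx 1).2) (sub_nonneg.2 (hx 0).2) hL.le
    (by ring) (r₁ := (d 0 * _ + _) / d 0) (r₂ := (_ + d 1 * _) / d 1)
    (div_nonneg (add_nonneg (mul_nonneg hd0.le hw₁) hw₂) hd0.le)
    (div_nonneg (add_nonneg hw₁ (mul_nonneg hd1.le hw₂)) hd1.le) hw₁ hw₂
    (le_of_eq_of_le ?_ ht) (by ring) (by ring) ?_ ?_ <;>
  · clear hw₁ hw₂ ht
    generalize hDD : (d 0 * d 1 - 1) * x 0 * x 1 + (x 0 + x 1 - 1) = D at *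
    field_simp
    rw [← hDD]
    ring

/-! ### The two inclusions -/

lemma mul_div_self_of_imp {y x : ℝ} (h : x = 0 → y = 0) : x * (y / x) = y := by
  rcases eq_or_ne x 0 with hx | hx
  · rw [h hx, hx]; simp
  · field_simp

lemma mul_mul_div_sq (δ y x : ℝ) : x * (δ * (y / x) ^ 2) = δ * y ^ 2 / x := by
  rcases eq_or_ne x 0 with hx | hx
  · simp [hx]
  · field_simp

lemma eq_zero_of_mul_sq {δ y : ℝ} (hδ : 0 < δ) (h : δ * y ^ 2 = 0) : y = 0 := by
  simpa [hδ.ne'] using h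

lemma mem_convexHull_of_fPlus_le (hd : d ∈ coeffSet) (hx : ∀ i, x i ∈ Set.Icc (0 : ℝ) 1)
    (hy : ∀ i, 0 ≤ y i) (ht : fPlus x y d ≤ (t : EReal)) :
    (x, y, t) ∈ convexHull ℝ (Zplus d) := by
  obtain ⟨hd0, hd1⟩ := coeffSet_pos hd
  have hx0 := (hx 0).1
  have hx1 := (hx 1).1
  have hx0' := sub_nonneg.2 (hx 0).2
  have hx1' := sub_nonneg.2 (hx 1).2
  have hy0 := hy 0
  have hy1 := hy 1
  unfold fPlus at ht
  split_ifs at ht with c₁ c₂ c₃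
  · obtain ⟨z₁, z₂, ht⟩ := (quot_add_quot_le_iff _ _ _ _ _).1 ht
    refine mem_convexHull_of_weights hd (a := 1 - x 0 - x 1) (b := x 0) (c := x 1) (e := 0)
      (r₁ := y 0 / x 0) (r₂ := y 1 / x 1) (w₁ := 0) (w₂ := 0) (by linarith) hx0 hx1 le_rfl
      (by ring) (by positivity) (by positivity) le_rfl le_rfl ?_ (by ring) (by ring) ?_ ?_
    · rw [mul_mul_div_sq, mul_mul_div_sq]; linarith
    · rw [mul_div_self_of_imp fun h => eq_zero_of_mul_sq hd0 (z₁ h)]; ring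
    · rw [mul_div_self_of_imp fun h => eq_zero_of_mul_sq hd1 (z₂ h)]; ring
  · have hL : 0 < x 0 + x 1 - 1 := by linarith
    obtain ⟨-, z₁, ht⟩ := (quot_add_quot_le_iff _ _ _ _ _).1 ht
    have hpos : 0 < x 1 := by linarith
    -- All of y₂ is spread evenly over the mass c + e = x₂, and all of y₁ goes to the piece (1,0) of
    -- mass 1 - x₂.
    refine mem_convexHull_of_weights hd (a := 0) (b := 1 - x 1) (c := 1 - x 0)
      (e := x 0 + x 1 - 1) (r₁ := y 0 / (1 - x 1)) (r₂ := y 1 / x 1) (w₁ := 0) (w₂ := y 1 / x 1)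
      le_rfl hx1' hx0' hL.le (by ring) (by positivity) (by positivity) le_rfl (by positivity)
      ?_ (by ring) (by ring) ?_ ?_
    · rw [mul_mul_div_sq]
      linarith [mul_mul_div_sq (d 1) (y 1) (x 1)]
    · rw [mul_div_self_of_imp fun h => eq_zero_of_mul_sq hd0 (z₁ h)]; ring
    · field_simp; ring
  · have hL : 0 < x 0 + x 1 - 1 := by linarith
    obtain ⟨-, z₁, ht⟩ := (quot_add_quot_le_iff _ _ _ _ _).1 ht
    have hpos : 0 < x 0 := by linarith
    refine mem_convexHull_of_weights hd (a := 0) (b := 1 - x 1) (c := 1 - x 0)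
      (e := x 0 + x 1 - 1) (r₁ := y 0 / x 0) (r₂ := y 1 / (1 - x 0)) (w₁ := y 0 / x 0) (w₂ := 0)
      le_rfl hx1' hx0' hL.le (by ring) (by positivity) (by positivity) (by positivity) le_rfl
      ?_ (by ring) (by ring) ?_ ?_
    · rw [mul_mul_div_sq (d 1)]
      linarith [mul_mul_div_sq (d 0) (y 0) (x 0)]
    · field_simp; ring
    · rw [mul_div_self_of_imp fun h => eq_zero_of_mul_sq hd1 (z₁ h)]; ring
  · have hL : 0 < x 0 + x 1 - 1 := by linarith
    rw [le_div_iff_of_overlap hy1 hL] at c₂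
    rw [add_comm (x 0), le_div_iff_of_overlap hy0 (by linarith)] at c₃
    obtain ⟨h₁, h₂⟩ := nonneg_of_not_dominant hy0 hy1 hx0' hx1' c₂ c₃
    exact mem_convexHull_of_ratFun_le hd hx hL h₁ h₂ (EReal.coe_le_coe_iff.1 ht)

lemma fPlus_le_of_mem_closure (hd : d ∈ coeffSet)
    (hp : (x, y, t) ∈ closure (convexHull ℝ (Zplus d))) : fPlus x y d ≤ (t : EReal) := by
  obtain ⟨hx, hy, -⟩ := mem_box_of_mem_closure hp
  dsimp only at hx hy
  unfold fPlus
  split_ifs with c₁ c₂ c₃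
  · exact separable_quot_le hd hp
  · rw [le_div_iff_of_overlap (hy 1) (by linarith)] at c₂
    exact quot_le_of_snd_dominant hd (hx 1).2 (by linarith [(hx 0).2]) hy c₂.2 hp
  · rw [add_comm (x 0), le_div_iff_of_overlap (hy 0) (by linarith)] at c₃
    exact quot_le_of_fst_dominant hd (hx 0).2 (by linarith [(hx 1).2]) hy c₃.2 hp
  · have hL : 0 < x 0 + x 1 - 1 := by linarith
    rw [le_div_iff_of_overlap (hy 1) hL] at c₂
    rw [add_comm (x 0), le_div_iff_of_overlap (hy 0) (by linarith)] at c₃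
    obtain ⟨h₁, h₂⟩ := nonneg_of_not_dominant (hy 0) (hy 1) (sub_nonneg.2 (hx 0).2)
      (sub_nonneg.2 (hx 1).2) c₂ c₃
    exact EReal.coe_le_coe_iff.2 (ratFun_le hd (fun i => (hx i).1) hL h₁ h₂ hp)

end RatFun

end IndicatorHull

theorem mainTheorem2 (d : Fin 2 → ℝ) (hd : d ∈ IndicatorHull.coeffSet) :
    closure (convexHull ℝ (IndicatorHull.Zplus d)) =
      {p : (Fin 2 → ℝ) × (Fin 2 → ℝ) × ℝ |
        (∀ i, p.1 i ∈ Set.Icc (0 : ℝ) 1) ∧ (∀ i, 0 ≤ p.2.1 i) ∧ 0 ≤ p.2.2 ∧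
          IndicatorHull.fPlus p.1 p.2.1 d ≤ (p.2.2 : EReal)} := by
  ext ⟨x, y, t⟩
  constructor
  · intro hp
    obtain ⟨hx, hy, ht⟩ := IndicatorHull.mem_box_of_mem_closure hp
    exact ⟨hx, hy, ht, IndicatorHull.fPlus_le_of_mem_closure hd hp⟩
  · rintro ⟨hx, hy, -, h⟩
    exact subset_closure (IndicatorHull.mem_convexHull_of_fPlus_le hd hx hy h)
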